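/- **Theorem 1.6.** Let $X$ be a standard Borel space and let $G$ be a Borel graph on $X$ (a symmetric irreflexive relation that is Borel as a subset of $X\times X$) in which every vertex has at most $2$ neighbors and which contains no odd cycles. Call a set $A\subseteq X$ *$G$-invariant* if it is a union of connected components of $G$. Let $E_G^{\mathrm{even}}$ be the equivalence relation on $X$ in which $x$ and $y$ are related if they are joined by a path of even length in $G$; a set is *$E_G^{\mathrm{even}}$-invariant* if it is a union of $E_G^{\mathrm{even}}$-classes. A vertex is *isolated* if it has no neighbors. 1. Let $\mu$ be a Borel probability measure on $X$ that is $G$-quasi-invariant, i.e. every $\mu$-null set is contained in a $G$-invariant $\mu$-null set. Then $G$ admits a $\mu$-measurable $2$-coloring (one that is measurable with respect to the completion of $\mu$) if and only if there does not exist a non-$\mu$-null $G$-invariant Borel set $A$ containing no isolated vertices such that every $E_G^{\mathrm{even}}$-invariant Borel set $C\subseteq A$ differs from a $G$-invariant set by a $\mu$-null set (i.e. $\mu(C\mathbin{\triangle}D)=0$ for some $G$-invariant $D\subseteq X$). 2. Let $\tau$ be a Polish topology on $X$ whose Borel $\sigma$-algebra is the given one and which is $G$-quasi-invariant, i.e.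 every $\tau$-meager set is contained in a $G$-invariant $\tau$-meager set. Then $G$ admits a Baire measurable $2$-coloring (one whose color classes have the Baire property with respect to $\tau$) if and only if there does not exist a non-$\tau$-meager $G$-invariant Borel set $A$ containing no isolated vertices such that every $E_G^{\mathrm{even}}$-invariant Borel set $C\subseteq A$ differs from a $G$-invariant set by a $\tau$-meager set (i.e. $C\mathbin{\triangle}D$ is $\tau$-meager for some $G$-invariant $D\subseteq X$). -/

import Mathlib

open MeasureTheory

namespace BorelGraph

variable {X : Type*}

/-- `A` is invariant under the relation `r`; for an equivalence relation: `A` is a union of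
`r`-classes. -/
def Invariant (r : X → X → Prop) (A : Set X) : Prop :=
  ∀ ⦃x y : X⦄, x ∈ A → r x y → y ∈ A

/-- `A` is `G`-invariant: a union of connected components of `G`. -/
def GInvariant (G : SimpleGraph X) (A : Set X) : Prop :=
  Invariant G.Reachable A

/-- `x` and `y` are joined by a (simple) path of even length in `G`. -/
def EvenConn (G : SimpleGraph X) (x y : X) : Prop :=
  ∃ p : G.Walk x y, p.IsPath ∧ Even p.length

/-- `G` contains no cycle of odd length. -/
def NoOddCycles (G : SimpleGraph X) : Prop :=
  ∀ (x : X) (p : G.Walk x x), p.IsCycle → ¬ Odd p.length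

/-- Every vertex of `G` has at most `d` neighbors. -/
def DegreeLE (G : SimpleGraph X) (d : ℕ) : Prop :=
  ∀ x : X, (G.neighborSet x).encard ≤ d

/-- The edge relation of `G` is a Borel subset of `X × X`. -/
def IsBorelGraph [MeasurableSpace X] (G : SimpleGraph X) : Prop :=
  MeasurableSet {p : X × X | G.Adj p.1 p.2}

/-- Every vertex of `A` has a neighbor in `G`. -/
def NoIsolatedIn (G : SimpleGraph X) (A : Set X) : Prop :=
  ∀ x ∈ A, ∃ y : X, G.Adj x y

/-- Every `μ`-null set is contained in a `G`-invariant `μ`-null set. -/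
def MeasureQuasiInvariant [MeasurableSpace X] (G : SimpleGraph X) (μ : Measure X) : Prop :=
  ∀ N : Set X, μ N = 0 → ∃ M : Set X, N ⊆ M ∧ GInvariant G M ∧ μ M = 0

/-- Every meager set is contained in a `G`-invariant meager set. -/
def TopologyQuasiInvariant [TopologicalSpace X] (G : SimpleGraph X) : Prop :=
  ∀ N : Set X, IsMeagre N → ∃ M : Set X, N ⊆ M ∧ GInvariant G M ∧ IsMeagre M

/-- Preimages of measurable sets have the Baire property. -/
def BaireMeasurable {Y : Type*} [TopologicalSpace X] [MeasurableSpace Y] (f : X → Y) : Prop :=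
  ∀ s : Set Y, MeasurableSet s → BaireMeasurableSet (f ⁻¹' s)

end BorelGraph

/-!
Measure and category are treated at once: let `l` be a filter closed under countable intersections
(the conull, respectively comeager, sets), and call the complements of its members *small*.  Three
properties of `l` are used: a small set lies in a small Borel set, a small set lies in a small
`G`-invariant set, and a disjoint family of Borel sets that are not small is countable.

*Descriptive input.*  As degrees are at most two, the edge relation splits into two Borel partial
functions (larger and smaller neighbor for a Borel linear order), so by the Lusin-Souslin theorem
the set `nbr G B` of neighbors of a Borel set `B` is Borel (`measurableSet_nbr`).  Hence small sets
lie in small `G`-invariant Borel sets.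

*A measurable coloring excludes the obstruction.*  Off a small invariant Borel set, the color class
`c ⁻¹' {0}` is Borel in `A`, and it is invariant under paths of even length.  If it agreed with a
`G`-invariant set off a small invariant set, two adjacent vertices would get the same color
(`not_obstruction_of_coloring`).

*Constructing a coloring.*  If a Borel set `C` is invariant under paths of even length, then
`C ∩ nbr G C` is `G`-invariant, while `C \ nbr G C` and its set of neighbors are the color classes
of a Borel coloring of a `G`-invariant Borel set.  So when there is no obstruction, every
`G`-invariant Borel set that is not small contains one that is not small and has a Borel
`2`-coloring (`exists_bicolored_subset`).  By countability of disjoint families, a maximal disjoint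
family of such sets covers everything up to a small invariant set, on which any `2`-coloring of the
bipartite graph `G` will do.
-/

namespace BorelGraph

open Filter Set

variable {X : Type*} {G : SimpleGraph X}

/-! ### Neighbors of Borel sets -/

/-- The set of vertices that have a neighbor in `B`. -/
def nbr (G : SimpleGraph X) (B : Set X) : Set X := {x | ∃ y ∈ B, G.Adj x y}

lemma DegreeLE.eq_or_eq (h : DegreeLE G 2) {x y z w : X} (hy : G.Adj x y) (hz : G.Adj x z)
    (hw : G.Adj x w) (hyz : y ≠ z) : w = y ∨ w = z := by
  by_contra! hne
  have hsub : ({y, z, w} : Set X) ⊆ G.neighborSet x := by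
    rintro a (rfl | rfl | rfl) <;> assumption
  have h3 : ({y, z, w} : Set X).encard = 3 :=
    encard_eq_three.mpr ⟨y, z, w, hyz, hne.1.symm, hne.2.symm, rfl⟩
  have := (encard_le_encard hsub).trans (h x)
  rw [h3] at this
  exact absurd this (by norm_num)

section Measurable

variable [MeasurableSpace X] [StandardBorelSpace X]

lemma measurableSet_nbr (hG : IsBorelGraph G) (hdeg : DegreeLE G 2) {B : Set X}
    (hB : MeasurableSet B) : MeasurableSet (nbr G B) := by
  let f := embeddingReal X
  have hf : MeasurableEmbedding f := measurableEmbedding_embeddingReal X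
  let P : Set (X × X) := {p | G.Adj p.1 p.2}
  have hP : MeasurableSet P := hG
  let T : Set ((X × X) × X) := {t | G.Adj t.1.1 t.1.2 ∧ G.Adj t.1.1 t.2 ∧ f t.2 < f t.1.2}
  have hT : MeasurableSet T := by
    refine (measurable_fst hP).inter (MeasurableSet.inter ?_ ?_)
    · exact ((measurable_fst.comp measurable_fst).prodMk measurable_snd) hP
    · exact measurableSet_lt (hf.measurable.comp measurable_snd)
        (hf.measurable.comp (measurable_snd.comp measurable_fst))
  -- `P₁` holds the edges `(x, y)` for which `y` is the larger of two neighbors of `x`.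
  let P₁ : Set (X × X) := Prod.fst '' T
  have hP₁ : MeasurableSet P₁ := by
    refine hT.image_of_measurable_injOn measurable_fst ?_
    rintro ⟨⟨x, y⟩, z⟩ ⟨hy, hz, hzy⟩ ⟨⟨x', y'⟩, w⟩ ⟨-, hw, hwy⟩ he
    obtain ⟨rfl, rfl⟩ := Prod.mk.inj he
    simp only at hy hz hzy hw hwy
    rcases hdeg.eq_or_eq hy hz hw (fun h => by simp [h] at hzy) with rfl | rfl
    · exact absurd hwy (lt_irrefl _)
    · rfl
  have hinj₁ : InjOn Prod.fst P₁ := by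
    rintro _ ⟨⟨⟨x, y⟩, z⟩, ⟨hy, hz, hzy⟩, rfl⟩ _ ⟨⟨⟨x', y'⟩, w⟩, ⟨hy', hw, hwy⟩, rfl⟩ he
    simp only at he hy hz hzy hy' hw hwy
    subst he
    by_contra hne
    have hne : y ≠ y' := fun h => hne (by rw [h])
    rcases hdeg.eq_or_eq hy hy' hz hne with rfl | rfl
    · exact lt_irrefl _ hzy
    rcases hdeg.eq_or_eq hy hy' hw hne with rfl | rfl
    · exact lt_asymm hzy hwy
    · exact lt_irrefl _ hwy
  have hinj₀ : InjOn Prod.fst (P \ P₁) := by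
    rintro ⟨x, y⟩ ⟨hy, hy₁⟩ ⟨x', y'⟩ ⟨hy', hy₁'⟩ he
    simp only at he
    subst he
    rcases lt_trichotomy (f y) (f y') with h | h | h
    · exact absurd ⟨((x, y'), y), ⟨hy', hy, h⟩, rfl⟩ hy₁'
    · rw [hf.injective h]
    · exact absurd ⟨((x, y), y'), ⟨hy, hy', h⟩, rfl⟩ hy₁
  have hsB : MeasurableSet (Prod.snd ⁻¹' B : Set (X × X)) := measurable_snd hB
  have key : nbr G B = Prod.fst '' (P₁ ∩ Prod.snd ⁻¹' B) ∪
      Prod.fst '' ((P \ P₁) ∩ Prod.snd ⁻¹' B) := by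
    rw [← image_union, ← union_inter_distrib_right]
    ext x
    constructor
    · rintro ⟨y, hy, hxy⟩
      by_cases h : (x, y) ∈ P₁
      · exact ⟨(x, y), ⟨Or.inl h, hy⟩, rfl⟩
      · exact ⟨(x, y), ⟨Or.inr ⟨hxy, h⟩, hy⟩, rfl⟩
    · rintro ⟨⟨x, y⟩, ⟨⟨⟨⟨_, z⟩, ⟨h, -⟩, rfl⟩⟩ | ⟨h, -⟩, hy⟩, rfl⟩
      · exact ⟨_, hy, h⟩
      · exact ⟨_, hy, h⟩
  rw [key]
  exact ((hP₁.inter hsB).image_of_measurable_injOn measurable_fst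
      (hinj₁.mono inter_subset_left)).union
    (((hP.diff hP₁).inter hsB).image_of_measurable_injOn measurable_fst
      (hinj₀.mono inter_subset_left))

end Measurable

/-! ### Invariant sets -/

lemma gInvariant_of_adj {A : Set X} (h : ∀ ⦃x y⦄, x ∈ A → G.Adj x y → y ∈ A) :
    GInvariant G A := by
  rintro x y hx ⟨p⟩
  induction p with
  | nil => exact hx
  | cons hadj _ ih => exact ih (h hx hadj)

lemma GInvariant.mem_of_adj {A : Set X} (h : GInvariant G A) {x y : X} (hx : x ∈ A)
    (hxy : G.Adj x y) : y ∈ A :=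
  h hx hxy.reachable

lemma GInvariant.compl {A : Set X} (h : GInvariant G A) : GInvariant G Aᶜ :=
  gInvariant_of_adj fun _ _ hx hxy hy => hx (h.mem_of_adj hy hxy.symm)

lemma GInvariant.inter {A B : Set X} (hA : GInvariant G A) (hB : GInvariant G B) :
    GInvariant G (A ∩ B) :=
  fun _ _ hx hxy => ⟨hA hx.1 hxy, hB hx.2 hxy⟩

lemma GInvariant.sUnion {F : Set (Set X)} (h : ∀ A ∈ F, GInvariant G A) :
    GInvariant G (⋃₀ F) :=
  fun _ _ ⟨A, hA, hx⟩ hxy => ⟨A, hA, h A hA hx hxy⟩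

lemma gInvariant_nbr_univ : GInvariant G (nbr G univ) :=
  gInvariant_of_adj fun x _ _ hxy => ⟨x, mem_univ x, hxy.symm⟩

lemma Invariant.mem_of_adj_adj {C : Set X} (h : Invariant (EvenConn G) C) {x y z : X}
    (hx : x ∈ C) (hxy : G.Adj x y) (hyz : G.Adj y z) : z ∈ C := by
  by_cases hxz : x = z
  · exact hxz ▸ hx
  · refine h hx ⟨.cons hxy (.cons hyz .nil), ?_, ?_⟩
    · simp [SimpleGraph.Walk.cons_isPath_iff, hxy.ne, hyz.ne, hxz]
    · exact even_two

lemma EvenConn.color_eq (c : G.Coloring (Fin 2)) {x y : X} (h : EvenConn G x y) : c x = c y := by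
  obtain ⟨p, -, hp⟩ := h
  let e := (finTwoEquiv : Fin 2 ≃ Bool)
  let c' : G.Coloring Bool := SimpleGraph.Coloring.mk (fun v => e (c v))
    fun hvw he => c.valid hvw (e.injective he)
  have h' : c' x ↔ c' y := (c'.even_length_iff_congr p).mp hp
  exact e.injective (Bool.eq_iff_iff.mpr h')

/-- Every set lies in the invariant set of all points joined to it by a path; it is the union of the
iterated neighbor sets. -/
lemma gInvariant_iUnion_iterate_nbr (B : Set X) : GInvariant G (⋃ n, (nbr G)^[n] B) := by
  refine gInvariant_of_adj fun x y hx hxy => ?_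
  obtain ⟨n, hn⟩ := mem_iUnion.mp hx
  refine mem_iUnion.mpr ⟨n + 1, ?_⟩
  rw [Function.iterate_succ_apply']
  exact ⟨x, hn, hxy.symm⟩

lemma GInvariant.iterate_nbr_subset {B M : Set X} (hM : GInvariant G M) (hB : B ⊆ M) (n : ℕ) :
    (nbr G)^[n] B ⊆ M := by
  induction n with
  | zero => exact hB
  | succ n ih =>
    rw [Function.iterate_succ_apply']
    rintro x ⟨y, hy, hxy⟩
    exact hM.mem_of_adj (ih hy) hxy.symm

/-! ### Borel sets with a Borel coloring -/

/-- `S` is a `G`-invariant Borel set on which `G` has a Borel `2`-coloring; the coloring is given by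
one of its classes `K`. -/
structure IsBicolored [MeasurableSpace X] (G : SimpleGraph X) (S : Set X) : Prop where
  measurableSet : MeasurableSet S
  gInvariant : GInvariant G S
  exists_class : ∃ K ⊆ S, MeasurableSet K ∧ ∀ x ∈ S, ∀ y, G.Adj x y → (x ∈ K ↔ y ∉ K)

section Filter

variable [MeasurableSpace X] [StandardBorelSpace X] {l : Filter X}

/-- The obstruction to a measurable coloring: the `G`-invariant Borel set `A` without isolated
vertices is not small, and modulo small sets its Borel subsets invariant under paths of even length
are `G`-invariant.  A set is small when its complement belongs to `l`. -/
def IsObstruction (G : SimpleGraph X) (l : Filter X) (A : Set X) : Prop :=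
  MeasurableSet A ∧ GInvariant G A ∧ NoIsolatedIn G A ∧ Aᶜ ∉ l ∧
    ∀ C : Set X, C ⊆ A → MeasurableSet C → Invariant (EvenConn G) C →
      ∃ D : Set X, GInvariant G D ∧ (symmDiff C D)ᶜ ∈ l

lemma exists_measurable_gInvariant_superset (hG : IsBorelGraph G) (hdeg : DegreeLE G 2)
    (hhull : ∀ s : Set X, sᶜ ∈ l → ∃ t ⊇ s, MeasurableSet t ∧ tᶜ ∈ l)
    (hinv : ∀ s : Set X, sᶜ ∈ l → ∃ t, s ⊆ t ∧ GInvariant G t ∧ tᶜ ∈ l)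
    {s : Set X} (hs : sᶜ ∈ l) : ∃ t ⊇ s, MeasurableSet t ∧ GInvariant G t ∧ tᶜ ∈ l := by
  obtain ⟨B, hsB, hB, hBl⟩ := hhull s hs
  obtain ⟨M, hBM, hM, hMl⟩ := hinv B hBl
  refine ⟨⋃ n, (nbr G)^[n] B, hsB.trans (subset_iUnion (fun n => (nbr G)^[n] B) 0),
    MeasurableSet.iUnion fun n => ?_, gInvariant_iUnion_iterate_nbr B, ?_⟩
  · induction n with
    | zero => exact hB
    | succ n ih =>
      rw [Function.iterate_succ_apply']
      exact measurableSet_nbr hG hdeg ih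
  · exact mem_of_superset hMl
      (compl_subset_compl.mpr (iUnion_subset (hM.iterate_nbr_subset hBM)))

omit [StandardBorelSpace X] in
theorem not_obstruction_of_coloring [CountableInterFilter l]
    (hull : ∀ s : Set X, sᶜ ∈ l → ∃ t ⊇ s, MeasurableSet t ∧ GInvariant G t ∧ tᶜ ∈ l)
    (c : G.Coloring (Fin 2))
    (hc : ∀ s, EventuallyMeasurableSet ‹MeasurableSpace X› l ((fun x => c x) ⁻¹' s))
    {A : Set X} (hA : IsObstruction G l A) : False := by
  obtain ⟨hAm, hAi, hAn, hAl, h⟩ := hA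
  obtain ⟨K, hK, hcK⟩ := hc {0}
  have hN : {x | ¬ (c x = 0 ↔ x ∈ K)}ᶜ ∈ l := by
    filter_upwards [eventuallyEq_set.mp hcK] with x hx
    simpa using hx
  obtain ⟨M, hNM, hM, hMi, hMl⟩ := hull _ hN
  have hC : ∀ x, x ∈ (A ∩ Mᶜ) ∩ K ↔ x ∈ A ∩ Mᶜ ∧ c x = 0 := by
    refine fun x => and_congr_right fun hx => ?_
    by_contra hne
    exact hx.2 (hNM fun h => hne h.symm)
  obtain ⟨D, hD, hDl⟩ := h ((A ∩ Mᶜ) ∩ K) (fun x hx => hx.1.1)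
    ((hAm.inter hM.compl).inter hK) (by
      intro x y hx hxy
      rw [hC] at hx ⊢
      refine ⟨hAi.inter hMi.compl hx.1 ?_, (hxy.color_eq c).symm.trans hx.2⟩
      exact hxy.elim fun p _ => p.reachable)
  obtain ⟨M', hNM', -, hMi', hMl'⟩ := hull _ hDl
  obtain ⟨x, hx, hxA⟩ : ∃ x, x ∈ Mᶜ ∩ M'ᶜ ∧ x ∈ A := by
    by_contra! hne
    exact hAl (mem_of_superset (inter_mem hMl hMl') hne)
  obtain ⟨y, hxy⟩ := hAn x hxA
  have hCD : ∀ z ∈ M'ᶜ, z ∈ (A ∩ Mᶜ) ∩ K ↔ z ∈ D := by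
    intro z hz
    by_contra hne
    refine hz (hNM' ?_)
    rw [mem_symmDiff]
    tauto
  have hyA := hAi.mem_of_adj hxA hxy
  have hyM := hMi.compl.mem_of_adj hx.1 hxy
  have hyM' := hMi'.compl.mem_of_adj hx.2 hxy
  have hcolor : c x = 0 ↔ c y = 0 := by
    have h₁ := (hC x).symm.trans (hCD x hx.2)
    have h₂ := (hC y).symm.trans (hCD y hyM')
    have hDxy : x ∈ D ↔ y ∈ D :=
      ⟨fun h => hD.mem_of_adj h hxy, fun h => hD.mem_of_adj h hxy.symm⟩
    rw [and_iff_right ⟨hxA, hx.1⟩] at h₁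
    rw [and_iff_right ⟨hyA, hyM⟩] at h₂
    rw [h₁, h₂, hDxy]
  have := c.valid hxy
  omega

/-- If a Borel set `C` is invariant under paths of even length, then `C \ nbr G C` is one class of a
Borel coloring of the set of points joined to it. -/
lemma isBicolored_of_even_invariant (hG : IsBorelGraph G) (hdeg : DegreeLE G 2) {C : Set X}
    (hC : MeasurableSet C) (hCi : Invariant (EvenConn G) C) :
    IsBicolored G (C \ nbr G C ∪ nbr G (C \ nbr G C)) := by
  have hK := hC.diff (measurableSet_nbr hG hdeg hC)
  have hstep : ∀ ⦃x y z⦄, x ∈ C \ nbr G C → G.Adj x y → G.Adj y z → z ∈ C \ nbr G C := by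
    rintro x y z hx hxy hyz
    refine ⟨hCi.mem_of_adj_adj hx.1 hxy hyz, ?_⟩
    rintro ⟨w, hw, hzw⟩
    exact hx.2 ⟨y, hCi.mem_of_adj_adj hw hzw.symm hyz.symm, hxy⟩
  refine ⟨hK.union (measurableSet_nbr hG hdeg hK), gInvariant_of_adj ?_,
    C \ nbr G C, subset_union_left, hK, ?_⟩
  · rintro x y (hx | ⟨w, hw, hxw⟩) hxy
    · exact Or.inr ⟨x, hx, hxy.symm⟩
    · exact Or.inl (hstep hw hxw.symm hxy)
  · rintro x (hx | ⟨w, hw, hxw⟩) y hxy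
    · exact iff_of_true hx fun hy => hx.2 ⟨y, hy.1, hxy⟩
    · refine iff_of_false (fun hx => hx.2 ⟨w, hw.1, hxw⟩) ?_
      exact not_not.mpr (hstep hw hxw.symm hxy)

lemma exists_bicolored_subset [CountableInterFilter l] (hG : IsBorelGraph G)
    (hdeg : DegreeLE G 2) (hno : ∀ A, ¬ IsObstruction G l A) {R : Set X} (hR : MeasurableSet R)
    (hRi : GInvariant G R) (hRl : Rᶜ ∉ l) : ∃ S ⊆ R, IsBicolored G S ∧ Sᶜ ∉ l := by
  have hV : MeasurableSet (nbr G univ) := measurableSet_nbr hG hdeg MeasurableSet.univ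
  by_cases hVl : (R ∩ nbr G univ)ᶜ ∈ l
  · -- Isolated vertices impose no condition on a coloring.
    refine ⟨R ∩ (nbr G univ)ᶜ, inter_subset_left, ⟨hR.inter hV.compl,
      hRi.inter gInvariant_nbr_univ.compl, ∅, empty_subset _, MeasurableSet.empty,
      fun x hx y hxy => absurd ⟨y, mem_univ y, hxy⟩ hx.2⟩, fun hl => hRl ?_⟩
    filter_upwards [hVl, hl] with x h₁ h₂ hx
    by_cases hxV : x ∈ nbr G univ
    · exact h₁ ⟨hx, hxV⟩
    · exact h₂ ⟨hx, hxV⟩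
  · have hobs := hno (R ∩ nbr G univ)
    simp only [IsObstruction, not_and] at hobs
    have hC := hobs (hR.inter hV) (hRi.inter gInvariant_nbr_univ)
      (fun x hx => hx.2.imp fun _ h => h.2) hVl
    push Not at hC
    obtain ⟨C, hCR, hCm, hCi, hCl⟩ := hC
    refine ⟨_, ?_, isBicolored_of_even_invariant hG hdeg hCm hCi, fun hl => ?_⟩
    · rintro x (hx | ⟨y, hy, hxy⟩)
      · exact (hCR hx.1).1
      · exact hRi.mem_of_adj (hCR hy.1).1 hxy.symm
    · refine hCl (C ∩ nbr G C) (gInvariant_of_adj ?_) (mem_of_superset hl ?_)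
      · rintro x y ⟨hx, w, hw, hxw⟩ hxy
        exact ⟨hCi.mem_of_adj_adj hw hxw.symm hxy, x, hx, hxy.symm⟩
      · refine compl_subset_compl.mpr fun x hx => Or.inl ?_
        rw [mem_symmDiff] at hx
        rcases hx with ⟨hx, hx'⟩ | ⟨hx, hx'⟩
        · exact ⟨hx, fun h => hx' ⟨hx, h⟩⟩
        · exact absurd hx.1 hx'

omit [StandardBorelSpace X] in
lemma IsBicolored.sUnion {F : Set (Set X)} (hF : ∀ S ∈ F, IsBicolored G S)
    (hd : F.PairwiseDisjoint id) (hc : F.Countable) : IsBicolored G (⋃₀ F) := by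
  choose! K hKS hK hKc using fun S hS => (hF S hS).exists_class
  refine ⟨.sUnion hc fun S hS => (hF S hS).measurableSet,
    .sUnion fun S hS => (hF S hS).gInvariant, ⋃ S ∈ F, K S,
    iUnion₂_subset fun S hS => (hKS S hS).trans (subset_sUnion_of_mem hS),
    .biUnion hc hK, ?_⟩
  rintro x ⟨S, hS, hx⟩ y hxy
  have hmem : ∀ z ∈ S, z ∈ ⋃ S ∈ F, K S ↔ z ∈ K S := by
    refine fun z hz => ⟨fun h => ?_, fun h => mem_biUnion hS h⟩
    obtain ⟨S', hS', hz'⟩ := mem_iUnion₂.mp h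
    rwa [hd.elim_set hS hS' z hz (hKS S' hS' hz')]
  rw [hmem x hx, hmem y ((hF S hS).gInvariant.mem_of_adj hx hxy)]
  exact hKc S hS x hx y hxy

theorem exists_coloring_of_no_obstruction [CountableInterFilter l] (hG : IsBorelGraph G)
    (hdeg : DegreeLE G 2) (hcol : G.Colorable 2)
    (hccc : ∀ F : Set (Set X), (∀ S ∈ F, MeasurableSet S) → (∀ S ∈ F, Sᶜ ∉ l) →
      F.PairwiseDisjoint id → F.Countable)
    (hno : ∀ A, ¬ IsObstruction G l A) :
    ∃ c : G.Coloring (Fin 2),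
      ∀ s, EventuallyMeasurableSet ‹MeasurableSpace X› l ((fun x => c x) ⁻¹' s) := by
  classical
  obtain ⟨F, hF⟩ := zorn_subset
    {F : Set (Set X) | (∀ S ∈ F, IsBicolored G S ∧ Sᶜ ∉ l) ∧ F.PairwiseDisjoint id} (by
      refine fun 𝒞 h𝒞 hchain => ⟨⋃₀ 𝒞, ⟨?_, ?_⟩, fun F hF => subset_sUnion_of_mem hF⟩
      · rintro S ⟨F, hF, hS⟩
        exact (h𝒞 hF).1 S hS
      · exact (pairwiseDisjoint_sUnion hchain.directedOn).mpr fun F hF => (h𝒞 hF).2)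
  obtain ⟨hFS, hFd⟩ := hF.prop
  have hFc : F.Countable :=
    hccc F (fun S hS => (hFS S hS).1.measurableSet) (fun S hS => (hFS S hS).2) hFd
  have hB := IsBicolored.sUnion (fun S hS => (hFS S hS).1) hFd hFc
  have hBl : ⋃₀ F ∈ l := by
    by_contra hBl
    obtain ⟨S, hSB, hS, hSl⟩ := exists_bicolored_subset hG hdeg hno hB.measurableSet.compl
      hB.gInvariant.compl (by rwa [compl_compl])
    have hdisj : ∀ T ∈ F, Disjoint S T := fun T hT =>
      (disjoint_compl_left.mono_left hSB).mono_right (subset_sUnion_of_mem hT)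
    have hmem : S ∈ F := by
      refine hF.le_of_ge (y := insert S F) ⟨?_, ?_⟩ (subset_insert S F) (mem_insert S F)
      · rintro T (rfl | hT)
        exacts [⟨hS, hSl⟩, hFS T hT]
      · exact hFd.insert fun T hT _ => hdisj T hT
    refine hSl ?_
    rw [disjoint_self.mp (hdisj S hmem)]
    simp
  obtain ⟨K, -, hK, hKc⟩ := hB.exists_class
  obtain ⟨c₀⟩ := hcol
  refine ⟨SimpleGraph.Coloring.mk
    (fun x => if x ∈ ⋃₀ F then (if x ∈ K then 0 else 1) else c₀ x) ?_, fun s => ?_⟩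
  · intro x y hxy
    by_cases hx : x ∈ ⋃₀ F
    · have hy := hB.gInvariant.mem_of_adj hx hxy
      have := hKc x hx y hxy
      by_cases hyK : y ∈ K <;> simp_all
    · have hy := hB.gInvariant.compl.mem_of_adj hx hxy
      rw [if_neg hx, if_neg hy]
      exact c₀.valid hxy
  · refine ⟨(fun x => if x ∈ K then (0 : Fin 2) else 1) ⁻¹' s,
      (Measurable.ite hK measurable_const measurable_const) (MeasurableSet.of_discrete), ?_⟩
    rw [eventuallyEq_set]
    filter_upwards [hBl] with x hx
    change (if x ∈ ⋃₀ F then (if x ∈ K then (0 : Fin 2) else 1) else c₀ x) ∈ s ↔ _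
    rw [if_pos hx]
    rfl

theorem exists_coloring_iff [CountableInterFilter l] (hG : IsBorelGraph G)
    (hdeg : DegreeLE G 2) (hcol : G.Colorable 2)
    (hhull : ∀ s : Set X, sᶜ ∈ l → ∃ t ⊇ s, MeasurableSet t ∧ tᶜ ∈ l)
    (hinv : ∀ s : Set X, sᶜ ∈ l → ∃ t, s ⊆ t ∧ GInvariant G t ∧ tᶜ ∈ l)
    (hccc : ∀ F : Set (Set X), (∀ S ∈ F, MeasurableSet S) → (∀ S ∈ F, Sᶜ ∉ l) →
      F.PairwiseDisjoint id → F.Countable) :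
    (∃ c : G.Coloring (Fin 2),
      ∀ s, MeasurableSet s →
        EventuallyMeasurableSet ‹MeasurableSpace X› l ((fun x => c x) ⁻¹' s)) ↔
      ¬ ∃ A, IsObstruction G l A := by
  constructor
  · rintro ⟨c, hc⟩ ⟨A, hA⟩
    exact not_obstruction_of_coloring
      (fun s hs => exists_measurable_gInvariant_superset hG hdeg hhull hinv hs) c
      (fun s => hc s .of_discrete) hA
  · intro hno
    obtain ⟨c, hc⟩ := exists_coloring_of_no_obstruction hG hdeg hcol hccc (not_exists.mp hno)
    exact ⟨c, fun s _ => hc s⟩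

end Filter

/-! ### Countable chain conditions -/

lemma countable_of_pairwiseDisjoint_of_measure_ne_zero [MeasurableSpace X] (μ : Measure X)
    [SFinite μ] {F : Set (Set X)} (hF : ∀ S ∈ F, MeasurableSet S) (h0 : ∀ S ∈ F, μ S ≠ 0)
    (hd : F.PairwiseDisjoint id) : F.Countable := by
  have := Measure.countable_meas_pos_of_disjoint_iUnion (μ := μ) (As := fun S : F => (S : Set X))
    (fun S => hF S S.2) (fun S T hST => hd S.2 T.2 (Subtype.coe_injective.ne hST))
  rw [eq_univ_of_forall (s := {S : F | 0 < μ (S : Set X)})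
    fun S => pos_iff_ne_zero.mpr (h0 S S.2)] at this
  exact countable_coe_iff.mp (countable_univ_iff.mp this)

/-- Disjoint nonmeager Borel sets agree modulo meager sets with disjoint nonempty open sets, by the
Baire category theorem. -/
lemma countable_of_pairwiseDisjoint_of_not_isMeagre [TopologicalSpace X] [BaireSpace X]
    [SecondCountableTopology X] [MeasurableSpace X] [BorelSpace X] {F : Set (Set X)}
    (hF : ∀ S ∈ F, MeasurableSet S) (h0 : ∀ S ∈ F, ¬ IsMeagre S)
    (hd : F.PairwiseDisjoint id) : F.Countable := by
  choose! U hU hSU using fun S hS => (hF S hS).residualEq_isOpen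
  refine Set.PairwiseDisjoint.countable_of_isOpen (s := U) ?_ hU ?_
  · intro S hS T hT hST
    have hres : (U S ∩ U T)ᶜ ∈ residual X := by
      filter_upwards [eventuallyEq_set.mp (hSU S hS), eventuallyEq_set.mp (hSU T hT)]
        with x hx hx' hxU
      exact disjoint_left.mp (hd hS hT hST) (hx.mpr hxU.1) (hx'.mpr hxU.2)
    rw [Function.onFun, disjoint_iff_inter_eq_empty, ← not_nonempty_iff_eq_empty]
    intro hne
    obtain ⟨x, hx, hx'⟩ := (dense_of_mem_residual hres).inter_open_nonempty _
      ((hU S hS).inter (hU T hT)) hne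
    exact hx' hx
  · intro S hS
    by_contra hne
    refine h0 S hS ?_
    change Sᶜ ∈ residual X
    filter_upwards [eventuallyEq_set.mp (hSU S hS)] with x hx hxS
    exact hne ⟨x, hx.mp hxS⟩

/-! ### Graphs without odd cycles are bipartite -/

lemma even_length_cons_of_isPath (h : NoOddCycles G) {u v : X} (huv : G.Adj u v) (p : G.Walk v u)
    (hp : p.IsPath) : Even (p.length + 1) := by
  by_cases he : s(u, v) ∈ p.edges
  · -- A path between the ends of an edge that runs through this edge consists of it alone.
    cases p with
    | nil => exact absurd huv (SimpleGraph.irrefl _)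
    | @cons _ x _ hvx q =>
      rw [SimpleGraph.Walk.cons_isPath_iff] at hp
      rw [SimpleGraph.Walk.edges_cons, List.mem_cons] at he
      rcases he with he | he
      · have hux : u = x := by
          rcases Sym2.eq_iff.mp he with ⟨rfl, -⟩ | ⟨rfl, -⟩
          · exact absurd huv (SimpleGraph.irrefl _)
          · rfl
        subst hux
        rw [(SimpleGraph.Walk.isPath_iff_nil.mp hp.1).eq_nil]
        exact even_two
      · exact absurd (q.snd_mem_support_of_mem_edges he) hp.2
  · have := h u (.cons huv p) (SimpleGraph.Walk.cons_isCycle_iff p huv |>.mpr ⟨hp, he⟩)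
    rwa [Nat.not_odd_iff_even, SimpleGraph.Walk.length_cons] at this

/-- Making a walk into a path removes closed walks that are cycles or run back and forth along an
edge; without odd cycles this preserves the parity of the length. -/
lemma even_length_bypass_iff [DecidableEq X] (h : NoOddCycles G) {u v : X} (p : G.Walk u v) :
    Even p.bypass.length ↔ Even p.length := by
  induction p with
  | nil => rfl
  | @cons u v w huv p ih =>
    rw [SimpleGraph.Walk.length_cons, Nat.even_add_one, ← ih, SimpleGraph.Walk.bypass]
    split_ifs with hs
    · have hsum := congrArg SimpleGraph.Walk.length (p.bypass.take_spec hs)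
      rw [SimpleGraph.Walk.length_append] at hsum
      have heven := even_length_cons_of_isPath h huv _ (p.bypass_isPath.takeUntil hs)
      rw [Nat.even_add_one] at heven
      rw [← hsum, Nat.even_add]
      tauto
    · rw [SimpleGraph.Walk.length_cons, Nat.even_add_one]

lemma NoOddCycles.colorable (h : NoOddCycles G) : G.Colorable 2 := by
  classical
  refine SimpleGraph.two_colorable_iff_forall_loop_even.mpr fun u w => ?_
  rw [← even_length_bypass_iff h w, (SimpleGraph.Walk.isPath_iff_nil.mp w.bypass_isPath).eq_nil]
  exact Even.zero

end BorelGraph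

theorem theorem1p6 {X : Type*} [MeasurableSpace X] [StandardBorelSpace X]
    (G : SimpleGraph X) (hG : BorelGraph.IsBorelGraph G)
    (hdeg : BorelGraph.DegreeLE G 2) (hodd : BorelGraph.NoOddCycles G) :
    (∀ (μ : Measure X) [IsProbabilityMeasure μ], BorelGraph.MeasureQuasiInvariant G μ →
      ((∃ c : G.Coloring (Fin 2), NullMeasurable (fun x => c x) μ) ↔
        ¬ ∃ A : Set X, MeasurableSet A ∧ BorelGraph.GInvariant G A ∧
          BorelGraph.NoIsolatedIn G A ∧ μ A ≠ 0 ∧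
          ∀ C : Set X, C ⊆ A → MeasurableSet C →
            BorelGraph.Invariant (BorelGraph.EvenConn G) C →
            ∃ D : Set X, BorelGraph.GInvariant G D ∧ μ (symmDiff C D) = 0)) ∧
    (∀ (τ : TopologicalSpace X) [PolishSpace X] [BorelSpace X],
      BorelGraph.TopologyQuasiInvariant G →
      ((∃ c : G.Coloring (Fin 2), BorelGraph.BaireMeasurable (fun x => c x)) ↔
        ¬ ∃ A : Set X, MeasurableSet A ∧ BorelGraph.GInvariant G A ∧
          BorelGraph.NoIsolatedIn G A ∧ ¬ IsMeagre A ∧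
          ∀ C : Set X, C ⊆ A → MeasurableSet C →
            BorelGraph.Invariant (BorelGraph.EvenConn G) C →
            ∃ D : Set X, BorelGraph.GInvariant G D ∧ IsMeagre (symmDiff C D))) := by
  refine ⟨fun μ _ hμ => ?_, fun _ _ _ hτ => ?_⟩
  · have key := BorelGraph.exists_coloring_iff (l := ae μ) hG hdeg hodd.colorable
      (fun s hs => by
        obtain ⟨t, hst, ht, ht0⟩ := exists_measurable_superset_of_null (compl_mem_ae_iff.mp hs)
        exact ⟨t, hst, ht, compl_mem_ae_iff.mpr ht0⟩)
      (fun s hs => by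
        simpa only [compl_mem_ae_iff] using hμ s (compl_mem_ae_iff.mp hs))
      (fun F hF h0 hd => BorelGraph.countable_of_pairwiseDisjoint_of_measure_ne_zero μ hF
        (fun S hS => by simpa only [compl_mem_ae_iff] using h0 S hS) hd)
    simp only [BorelGraph.IsObstruction, compl_mem_ae_iff] at key
    exact key
  · have key := BorelGraph.exists_coloring_iff (l := residual X) hG hdeg hodd.colorable
      (fun s hs => by
        obtain ⟨t, hts, ht, htd⟩ := mem_residual.mp hs
        refine ⟨tᶜ, Set.subset_compl_comm.mp hts, ht.measurableSet.compl, ?_⟩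
        rw [compl_compl]
        exact residual_of_dense_Gδ ht htd)
      hτ
      (fun F hF h0 hd => BorelGraph.countable_of_pairwiseDisjoint_of_not_isMeagre hF h0 hd)
    have hborel : ‹MeasurableSpace X› = borel X := BorelSpace.measurable_eq
    simp only [BorelGraph.IsObstruction] at key
    subst hborel
    exact key
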